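/- Let $n\ge 4$. A $(0,1)$ companion matrix of order $n$ is a real $n\times n$ matrix with $1$'s on the superdiagonal, arbitrary last row $(a_{n1},\dots,a_{nn})\in\{0,1\}^n$, and zeros elsewhere. Let $\mathcal{PSC}_n^{0,0}$ be the set of all matrices of the form $A+A^T$, where $A$ is a $(0,1)$ companion matrix of order $n$ with $a_{n1}=a_{nn}=0$, that are primitive (nonnegative with some positive power having all entries positive). The exponent $\exp(B)$ of a primitive matrix $B$ is the least $k\ge 1$ such that all entries of $B^k$ are positive. Let $N_n^{0,0}(b)$ be the number of $B\in\mathcal{PSC}_n^{0,0}$ with $\exp(B)=b$. For $m\ge 0$ let $F_m(q,k)$ be the number of binary strings of length $m$ that have exactly $q$ zeros and whose longest subword of consecutive zeros has length $k$. Binomial coefficients $\binom{m}{q}$ are taken to be $0$ when $m<q$ (including negative $m$). 1. If $n\ge 4$, then $N_n^{0,0}(2n-4)=2$. 2. If $n\ge 5$, then $$2\sum_{q=0}^{\lfloor (n+1)/3\rfloor}\binom{n-2q-4}{q}\;\le\; N_n^{0,0}(4)\;\le\; 2\left[\sum_{q=1}^{\lfloor (2n-7)/5\rfloor}F_{n-5}(q,1)+\sum_{q=2}^{\lfloor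 (2n+2)/3\rfloor}F_{n-5}(q,2)+1\right].$$ -/

import Mathlib

namespace SymmCompanion

/-- The `n × n` real matrix with ones on the superdiagonal, last row `a`, and zeros elsewhere. -/
def companionOfLastRow {n : ℕ} (a : Fin n → ℝ) : Matrix (Fin n) (Fin n) ℝ :=
  Matrix.of fun i j =>
    if i.val + 1 = n then a j else if j.val = i.val + 1 then 1 else 0

/-- The set `C_n^{α,e}` of all `A + Aᵀ`, where `A` is an `n × n` companion matrix whose last row
has entries in `{0, 1}`, first entry `α` and last entry `e`. -/
def symmCompanion (n : ℕ) (α e : ℝ) : Set (Matrix (Fin n) (Fin n) ℝ) :=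
  {B | ∃ a : Fin n → ℝ, (∀ j, a j = 0 ∨ a j = 1) ∧
    (∀ j : Fin n, j.val = 0 → a j = α) ∧
    (∀ j : Fin n, j.val + 1 = n → a j = e) ∧
    B = companionOfLastRow a + (companionOfLastRow a).transpose}

/-- The set `PSC_n^{α,e}` of primitive matrices in `C_n^{α,e}`. -/
def primSymmCompanion (n : ℕ) (α e : ℝ) : Set (Matrix (Fin n) (Fin n) ℝ) :=
  {B | B ∈ symmCompanion n α e ∧ B.IsPrimitive}

/-- The exponent of a primitive matrix: the least `k ≥ 1` such that all entries of `B ^ k` are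
positive. -/
noncomputable def primExp {n : ℕ} (B : Matrix (Fin n) (Fin n) ℝ) : ℕ :=
  sInf {k : ℕ | 0 < k ∧ ∀ i j, 0 < (B ^ k) i j}

theorem symmCompanion_finite (n : ℕ) (α e : ℝ) : (symmCompanion n α e).Finite := by
  have h : (Set.univ.pi fun _ : Fin n => ({0, 1} : Set ℝ)).Finite :=
    Set.Finite.pi fun _ => Set.toFinite _
  refine (h.image fun a => companionOfLastRow a + (companionOfLastRow a).transpose).subset ?_
  rintro B ⟨a, ha, -, -, rfl⟩
  exact ⟨a, fun j _ => ha j, rfl⟩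

/-- `N_n^{α,e}(b)`: the number of matrices in `PSC_n^{α,e}` of exponent `b` (this set is finite,
see `symmCompanion_finite`). -/
noncomputable def numExp (n : ℕ) (α e : ℝ) (b : ℕ) : ℕ :=
  {B | B ∈ primSymmCompanion n α e ∧ primExp B = b}.ncard

/-- The binary string `Y` has a subword of `k` consecutive zeros (`false` is the letter `0`). -/
def HasZeroRun {m : ℕ} (Y : Fin m → Bool) (k : ℕ) : Prop :=
  ∃ s : ℕ, s + k ≤ m ∧ ∀ j : Fin m, s ≤ j.val → j.val < s + k → Y j = false

/-- `F_m(q,k)`: the number of binary strings of length `m` with exactly `q` zeros whose longest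
subwords of consecutive zeros have length `k`. -/
noncomputable def numStrings (m q k : ℕ) : ℕ :=
  {Y : Fin m → Bool | {j : Fin m | Y j = false}.ncard = q ∧
    IsGreatest {l : ℕ | HasZeroRun Y l} k}.ncard

end SymmCompanion

namespace SymmCompanion

/-! Positivity of powers depends only on the zero pattern of the matrix, so everything reduces to
walks in a graph: the path `0, …, n-1` plus chords from the hub `n-1` to those `j` in `[1, n-3]`
with `s j`. The entry in column `n-2` of the last row only turns a 1 into a 2 on an existing edge;
this free bit `c` is the factor 2 in every count. `AllWalks` is monotone in the length, so exponent
`b + 1` means `AllWalks` at `b + 1` but not at `b`.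

Exponent `2n-4`: primitivity needs an odd cycle, hence a chord `p` with `p` and `n` of different
parity. Such a chord with `p ≤ n-5`, or the chord `n-3` together with any other, already gives
`AllWalks` at `2n-5`. Only the path with a triangle at its end remains, and there `Walk.lollipop`
excludes closed walks of length `2n-5` at `0` (`allWalks_max_iff`).

Exponent 4: length 3 never suffices. For the lower bound, it is enough that every vertex reaches the
hub in two steps; this holds if the missing chords avoid `1`, `2`, `n-3` and are at least 3 apart,
and such sets are counted by a Pascal-type recursion. For the upper bound, length 4 forces chords
`1` and `2` and forbids both three consecutive missing chords and certain alternating patterns;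
blocks of three or five positions then bound the number of zeros. -/

/-! ### Parametrisation of the matrices by a bit and a chord set -/

/-- The symmetric matrix `A + Aᵀ` whose companion matrix `A` has last row `0, s 1, …, s (n-3), c, 0`
(as a `(0,1)`-row). -/
def symmOf (n : ℕ) (c : Bool) (s : ℕ → Bool) : Matrix (Fin n) (Fin n) ℝ :=
  let a : Fin n → ℝ := fun j =>
    if j.val = 0 ∨ j.val + 1 = n then 0
    else if j.val + 2 = n then (if c then 1 else 0) else if s j.val then 1 else 0
  companionOfLastRow a + (companionOfLastRow a).transpose

theorem symmOf_mem {n : ℕ} (c : Bool) (s : ℕ → Bool) : symmOf n c s ∈ symmCompanion n 0 0 := by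
  refine ⟨_, ?_, ?_, ?_, rfl⟩
  · intro j
    split_ifs <;> simp
  · intro j hj
    simp [hj]
  · intro j hj
    simp [hj]

theorem exists_eq_symmOf {n : ℕ} {B : Matrix (Fin n) (Fin n) ℝ} (hB : B ∈ symmCompanion n 0 0) :
    ∃ c s, B = symmOf n c s := by
  classical
  obtain ⟨a, ha, h0, h1, rfl⟩ := hB
  refine ⟨decide (∃ j : Fin n, j.val + 2 = n ∧ a j = 1),
    fun p => decide (∃ j : Fin n, j.val = p ∧ a j = 1), ?_⟩
  have : a = fun j : Fin n =>
    if j.val = 0 ∨ j.val + 1 = n then (0 : ℝ)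
    else if j.val + 2 = n then
      (if decide (∃ j : Fin n, j.val + 2 = n ∧ a j = 1) = true then 1 else 0)
    else if decide (∃ i : Fin n, i.val = j.val ∧ a i = 1) = true then 1 else 0 := by
    funext j
    have key : ∀ i : Fin n, i.val = j.val → i = j := fun i hi => Fin.ext hi
    split_ifs with h2 h3 h4 h5
    · rcases h2 with h2 | h2
      · exact h0 j h2
      · exact h1 j h2
    · obtain ⟨i, hi, hi'⟩ := of_decide_eq_true h4
      rw [← key i (by omega)]; exact hi'
    · rcases ha j with h | h
      · exact h
      · exact absurd (decide_eq_true ⟨j, h3, h⟩) h4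
    · obtain ⟨i, hi, hi'⟩ := of_decide_eq_true h5
      rw [← key i (by omega)]; exact hi'
    · rcases ha j with h | h
      · exact h
      · exact absurd (decide_eq_true ⟨j, rfl, h⟩) h5
  unfold symmOf
  dsimp only
  rw [← this]

theorem symmOf_congr {n : ℕ} {c : Bool} {s t : ℕ → Bool}
    (h : ∀ p, 1 ≤ p → p + 3 ≤ n → s p = t p) : symmOf n c s = symmOf n c t := by
  have : ∀ j : Fin n, (if j.val = 0 ∨ j.val + 1 = n then (0 : ℝ)
    else if j.val + 2 = n then (if c then 1 else 0) else if s j.val then 1 else 0) =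
    (if j.val = 0 ∨ j.val + 1 = n then (0 : ℝ)
    else if j.val + 2 = n then (if c then 1 else 0) else if t j.val then 1 else 0) := by
    intro j
    have := j.isLt
    split_ifs with h1 h2 h3 h4 h5 h6 <;> first
      | rfl
      | (have := h j.val (by omega) (by omega); simp_all)
  unfold symmOf
  simp only [this]

theorem symmOf_last_apply {n : ℕ} (c : Bool) (s : ℕ → Bool) (i j : Fin n) (hi : i.val + 1 = n)
    (hj : 1 ≤ j.val) (hj' : j.val + 3 ≤ n) : symmOf n c s i j = if s j.val then 1 else 0 := by
  simp only [symmOf, companionOfLastRow, Matrix.add_apply, Matrix.transpose_apply, Matrix.of_apply]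
  split_ifs <;> first | (exfalso; omega) | norm_num

theorem symmOf_last_penultimate {n : ℕ} (hn : 3 ≤ n) (c : Bool) (s : ℕ → Bool) (i j : Fin n)
    (hi : i.val + 1 = n) (hj : j.val + 2 = n) :
    symmOf n c s i j = (if c then 1 else 0) + 1 := by
  simp only [symmOf, companionOfLastRow, Matrix.add_apply, Matrix.transpose_apply, Matrix.of_apply]
  split_ifs <;> first | (exfalso; omega) | norm_num

theorem symmOf_inj {n : ℕ} (hn : 3 ≤ n) {c d : Bool} {s t : ℕ → Bool}
    (h : symmOf n c s = symmOf n d t) : c = d ∧ ∀ p, 1 ≤ p → p + 3 ≤ n → s p = t p := by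
  constructor
  · have := congrFun (congrFun h ⟨n - 1, by omega⟩) ⟨n - 2, by omega⟩
    rw [symmOf_last_penultimate hn _ _ _ _ (by simp; omega) (by simp; omega),
      symmOf_last_penultimate hn _ _ _ _ (by simp; omega) (by simp; omega)] at this
    cases c <;> cases d <;> simp_all
  · intro p hp hp'
    have := congrFun (congrFun h ⟨n - 1, by omega⟩) ⟨p, by omega⟩
    rw [symmOf_last_apply _ _ _ _ (by simp; omega) hp hp',
      symmOf_last_apply _ _ _ _ (by simp; omega) hp hp'] at this
    dsimp only at this
    cases h1 : s p <;> cases h2 : t p <;> simp_all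

/-! ### Positive entries of powers as walks in a graph -/

/-- Adjacency in the graph of `symmOf n c s`: the path `0, 1, …, n-1` with additional edges joining
`n-1` to those `j` in `[1, n-3]` for which `s j` holds. -/
def Adj (n : ℕ) (s : ℕ → Bool) (i j : ℕ) : Prop :=
  i + 1 = j ∨ j + 1 = i ∨ (i + 1 = n ∧ 1 ≤ j ∧ j + 3 ≤ n ∧ s j = true) ∨
    (j + 1 = n ∧ 1 ≤ i ∧ i + 3 ≤ n ∧ s i = true)

theorem Adj.symm {n : ℕ} {s : ℕ → Bool} {i j : ℕ} (h : Adj n s i j) : Adj n s j i := by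
  unfold Adj at *; tauto

theorem symmOf_nonneg {n : ℕ} (c : Bool) (s : ℕ → Bool) (i j : Fin n) : 0 ≤ symmOf n c s i j := by
  simp only [symmOf, companionOfLastRow, Matrix.add_apply, Matrix.transpose_apply, Matrix.of_apply]
  apply add_nonneg <;> (split_ifs <;> norm_num)

/-- The bit `c` disappears here, because `n-2` and `n-1` are already neighbours on the path. -/
theorem symmOf_pos_iff {n : ℕ} (hn : 2 ≤ n) (c : Bool) (s : ℕ → Bool) (i j : Fin n) :
    0 < symmOf n c s i j ↔ Adj n s i j := by
  have hi := i.isLt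
  have hj := j.isLt
  have comp_pos : ∀ i j : Fin n, 0 < companionOfLastRow (fun j : Fin n =>
      if j.val = 0 ∨ j.val + 1 = n then (0 : ℝ)
      else if j.val + 2 = n then (if c then 1 else 0) else if s j.val then 1 else 0) i j ↔
      (i.val + 1 = j.val ∨ (i.val + 1 = n ∧ 1 ≤ j.val ∧ j.val + 3 ≤ n ∧ s j.val = true) ∨
        (i.val + 1 = n ∧ j.val + 2 = n ∧ 1 ≤ j.val ∧ c = true)) := by
    intro i j
    have hi := i.isLt
    have hj := j.isLt
    simp only [companionOfLastRow, Matrix.of_apply]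
    split_ifs with h1 h2 h3 h4 h5 h6
    · simp only [lt_irrefl, false_iff]; omega
    · simp only [zero_lt_one, true_iff]
      exact Or.inr (Or.inr ⟨h1, h3, by omega, h4⟩)
    · simp only [lt_irrefl, false_iff]
      rintro (h | h | h)
      · omega
      · omega
      · exact h4 h.2.2.2
    · simp only [zero_lt_one, true_iff]
      exact Or.inr (Or.inl ⟨h1, by omega, by omega, h5⟩)
    · simp only [lt_irrefl, false_iff]
      rintro (h | h | h)
      · omega
      · exact h5 h.2.2.2
      · omega
    · simp only [zero_lt_one, true_iff]; omega
    · simp only [lt_irrefl, false_iff]; omega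
  have comp_nonneg : ∀ i j : Fin n, 0 ≤ companionOfLastRow (fun j : Fin n =>
      if j.val = 0 ∨ j.val + 1 = n then (0 : ℝ)
      else if j.val + 2 = n then (if c then 1 else 0) else if s j.val then 1 else 0) i j := by
    intro i j
    simp only [companionOfLastRow, Matrix.of_apply]
    split_ifs <;> norm_num
  have add_pos_iff : ∀ x y : ℝ, 0 ≤ x → 0 ≤ y → (0 < x + y ↔ 0 < x ∨ 0 < y) := by
    intro x y hx hy
    constructor
    · intro h
      by_contra! h'
      linarith
    · rintro (h | h) <;> linarith
  simp only [symmOf, Matrix.add_apply, Matrix.transpose_apply]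
  rw [add_pos_iff _ _ (comp_nonneg i j) (comp_nonneg j i), comp_pos, comp_pos]
  unfold Adj
  constructor
  · rintro ((h | h | h) | (h | h | h))
    · exact Or.inl h
    · exact Or.inr (Or.inr (Or.inl h))
    · right; left; omega
    · exact Or.inr (Or.inl h)
    · exact Or.inr (Or.inr (Or.inr h))
    · left; omega
  · rintro (h | h | h | h)
    · exact Or.inl (Or.inl h)
    · exact Or.inr (Or.inl h)
    · exact Or.inl (Or.inr (Or.inl h))
    · exact Or.inr (Or.inr (Or.inl h))

/-- `Walk n s k i j`: there is a walk of length `k` from `i` to `j`, whose later vertices are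
below `n`. -/
def Walk (n : ℕ) (s : ℕ → Bool) : ℕ → ℕ → ℕ → Prop
  | 0, i, j => i = j
  | k + 1, i, j => ∃ l < n, Walk n s k i l ∧ Adj n s l j

theorem symmOf_pow_nonneg {n : ℕ} (c : Bool) (s : ℕ → Bool) (k : ℕ) (i j : Fin n) :
    0 ≤ (symmOf n c s ^ k) i j := by
  induction k generalizing j with
  | zero =>
    rw [pow_zero, Matrix.one_apply]
    split_ifs <;> norm_num
  | succ k ih =>
    rw [pow_succ, Matrix.mul_apply]
    exact Finset.sum_nonneg fun l _ => mul_nonneg (ih l) (symmOf_nonneg c s l j)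

theorem symmOf_pow_pos_iff {n : ℕ} (hn : 2 ≤ n) (c : Bool) (s : ℕ → Bool) (k : ℕ) (i j : Fin n) :
    0 < (symmOf n c s ^ k) i j ↔ Walk n s k i j := by
  induction k generalizing j with
  | zero =>
    rw [pow_zero, Matrix.one_apply, Walk, ← Fin.ext_iff]
    split_ifs with h <;> simp [h]
  | succ k ih =>
    rw [pow_succ, Matrix.mul_apply, Walk, Finset.sum_pos_iff_of_nonneg fun l _ =>
      mul_nonneg (symmOf_pow_nonneg c s k i l) (symmOf_nonneg c s l j)]
    constructor
    · rintro ⟨l, -, h⟩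
      refine ⟨l, l.isLt, (ih l).1 ?_, (symmOf_pos_iff hn c s l j).1 ?_⟩
      · exact pos_of_mul_pos_left h (symmOf_nonneg c s l j)
      · exact pos_of_mul_pos_right h (symmOf_pow_nonneg c s k i l)
    · rintro ⟨l, hl, h1, h2⟩
      exact ⟨⟨l, hl⟩, Finset.mem_univ _,
        mul_pos ((ih ⟨l, hl⟩).2 h1) ((symmOf_pos_iff hn c s ⟨l, hl⟩ j).2 h2)⟩

/-- Any two vertices are joined by a walk of length `k`. -/
def AllWalks (n : ℕ) (s : ℕ → Bool) (k : ℕ) : Prop := ∀ i < n, ∀ j < n, Walk n s k i j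

theorem symmOf_pow_pos_all_iff {n : ℕ} (hn : 2 ≤ n) (c : Bool) (s : ℕ → Bool) (k : ℕ) :
    (∀ i j, 0 < (symmOf n c s ^ k) i j) ↔ AllWalks n s k := by
  constructor
  · intro h i hi j hj
    exact (symmOf_pow_pos_iff hn c s k ⟨i, hi⟩ ⟨j, hj⟩).1 (h _ _)
  · intro h i j
    exact (symmOf_pow_pos_iff hn c s k i j).2 (h i i.isLt j j.isLt)

theorem primExp_symmOf_eq_iff {n : ℕ} (hn : 2 ≤ n) (c : Bool) (s : ℕ → Bool) (b : ℕ) (hb : 0 < b) :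
    (symmOf n c s ∈ primSymmCompanion n 0 0 ∧ primExp (symmOf n c s) = b) ↔
      AllWalks n s b ∧ ∀ k, 0 < k → k < b → ¬ AllWalks n s k := by
  unfold primExp
  simp only [symmOf_pow_pos_all_iff hn]
  constructor
  · rintro ⟨-, rfl⟩
    -- Since `sInf ∅ = 0`, positivity of the exponent shows that some power is positive.
    refine ⟨(Nat.sInf_mem (Nat.nonempty_of_pos_sInf hb)).2, fun k hk hk' h => ?_⟩
    exact Nat.notMem_of_lt_sInf hk' ⟨hk, h⟩
  · rintro ⟨h1, h2⟩
    refine ⟨⟨symmOf_mem c s, symmOf_nonneg c s, b, hb, ?_⟩, ?_⟩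
    · exact (symmOf_pow_pos_all_iff hn c s b).2 h1
    · refine le_antisymm (Nat.sInf_le ⟨hb, h1⟩) (le_csInf ⟨b, hb, h1⟩ ?_)
      rintro k ⟨hk, h⟩
      by_contra! hlt
      exact h2 k hk hlt h

theorem Walk.trans {n : ℕ} {s : ℕ → Bool} {k l i j m : ℕ} (h1 : Walk n s k i j)
    (h2 : Walk n s l j m) : Walk n s (k + l) i m := by
  induction l generalizing m with
  | zero => cases h2; exact h1
  | succ l ih =>
    obtain ⟨p, hp, h3, h4⟩ := h2
    exact ⟨p, hp, ih h3, h4⟩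

theorem Walk.of_adj {n : ℕ} {s : ℕ → Bool} {i j : ℕ} (hi : i < n) (h : Adj n s i j) :
    Walk n s 1 i j := ⟨i, hi, rfl, h⟩

theorem walk_up {n : ℕ} (s : ℕ → Bool) (i k : ℕ) (h : i + k ≤ n) : Walk n s k i (i + k) := by
  induction k with
  | zero => rfl
  | succ k ih => exact ⟨i + k, by omega, ih (by omega), Or.inl rfl⟩

theorem walk_down {n : ℕ} (s : ℕ → Bool) (i k : ℕ) (h : i + k < n) : Walk n s k (i + k) i := by
  induction k with
  | zero => rfl
  | succ k ih =>
    have h1 : Walk n s 1 (i + (k + 1)) (i + k) := Walk.of_adj h (Or.inr (Or.inl (by omega)))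
    have := h1.trans (ih (by omega))
    rwa [Nat.add_comm 1 k] at this

/-- The walk along the path. -/
theorem walk_path {n : ℕ} (s : ℕ → Bool) {i j : ℕ} (hi : i < n) (hj : j < n) :
    Walk n s (i - j + (j - i)) i j := by
  rcases le_total i j with h | h
  · obtain ⟨k, rfl⟩ := Nat.exists_eq_add_of_le h
    have := walk_up (n := n) s i k hj.le
    rwa [show i - (i + k) + (i + k - i) = k by omega]
  · obtain ⟨k, rfl⟩ := Nat.exists_eq_add_of_le h
    have := walk_down (n := n) s j k hi
    rwa [show j + k - j + (j - (j + k)) = k by omega]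

/-- Every vertex has a neighbour on the path, so a walk can end with a step away and back. -/
theorem Walk.add_two {n : ℕ} {s : ℕ → Bool} {k i j : ℕ} (hn : 2 ≤ n) (hj : j < n)
    (h : Walk n s k i j) : Walk n s (k + 2) i j := by
  by_cases h0 : j + 1 < n
  · exact ⟨j + 1, h0, ⟨j, hj, h, Or.inl rfl⟩, Or.inr (Or.inl rfl)⟩
  · exact ⟨j - 1, by omega, ⟨j, hj, h, Or.inr (Or.inl (by omega))⟩, Or.inl (by omega)⟩

theorem Walk.mono {n : ℕ} {s : ℕ → Bool} {k l i j : ℕ} (hn : 2 ≤ n) (hj : j < n)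
    (h : Walk n s k i j) (hkl : k ≤ l) (hp : k % 2 = l % 2) : Walk n s l i j := by
  obtain ⟨d, rfl⟩ : ∃ d, l = k + 2 * d := ⟨(l - k) / 2, by omega⟩
  clear hkl hp
  induction d with
  | zero => exact h
  | succ d ih => exact ih.add_two hn hj

theorem AllWalks.succ {n : ℕ} {s : ℕ → Bool} {k : ℕ} (hn : 2 ≤ n) (h : AllWalks n s k) :
    AllWalks n s (k + 1) := by
  intro i hi j hj
  by_cases h0 : j + 1 < n
  · exact ⟨j + 1, h0, h i hi _ h0, Or.inr (Or.inl rfl)⟩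
  · exact ⟨j - 1, by omega, h i hi _ (by omega), Or.inl (by omega)⟩

theorem AllWalks.mono {n : ℕ} {s : ℕ → Bool} {k l : ℕ} (hn : 2 ≤ n) (h : AllWalks n s k)
    (hkl : k ≤ l) : AllWalks n s l := by
  induction l, hkl using Nat.le_induction with
  | base => exact h
  | succ l _ ih => exact ih.succ hn

theorem symmOf_exp_eq_iff {n : ℕ} (hn : 2 ≤ n) (c : Bool) (s : ℕ → Bool) (b : ℕ) (hb : 0 < b) :
    (symmOf n c s ∈ primSymmCompanion n 0 0 ∧ primExp (symmOf n c s) = b + 1) ↔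
      AllWalks n s (b + 1) ∧ ¬ AllWalks n s b := by
  rw [primExp_symmOf_eq_iff hn c s _ (Nat.succ_pos b)]
  refine and_congr_right fun _ => ⟨fun h => h b hb (Nat.lt_succ_self b), fun h k _ hkb hk => ?_⟩
  exact h (hk.mono hn (Nat.lt_succ_iff.1 hkb))

/-- The walk from `u` along the path to `i`, then to `n-1`, then along the path to `v`. -/
theorem walk_via {n : ℕ} {s : ℕ → Bool} {i u v : ℕ} (hi : 1 ≤ i) (hin : i + 3 ≤ n)
    (hs : s i = true) (hu : u < n) (hv : v < n) :
    Walk n s (u - i + (i - u) + 1 + (n - 1 - v)) u v := by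
  have h1 := walk_path s hu (show i < n by omega)
  have h2 : Walk n s 1 i (n - 1) :=
    Walk.of_adj (by omega) (Or.inr (Or.inr (Or.inr ⟨by omega, hi, hin, hs⟩)))
  have h3 := walk_path s (show n - 1 < n by omega) hv
  have := (h1.trans h2).trans h3
  rwa [show n - 1 - v + (v - (n - 1)) = n - 1 - v by omega] at this

theorem Walk.symm {n : ℕ} {s : ℕ → Bool} {k i j : ℕ} (hj : j < n)
    (h : Walk n s k i j) : Walk n s k j i := by
  induction k generalizing j with
  | zero => exact Eq.symm h
  | succ k ih =>
    obtain ⟨l, hl, h1, h2⟩ := h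
    have := (Walk.of_adj hj h2.symm).trans (ih hl h1)
    rwa [Nat.add_comm 1 k] at this

/-! ### The largest exponent -/

theorem allWalks_of_le {n : ℕ} {s : ℕ → Bool} {k : ℕ}
    (h : ∀ u v, u ≤ v → v < n → Walk n s k u v) : AllWalks n s k := by
  intro i hi j hj
  rcases le_total i j with hij | hij
  · exact h i j hij hj
  · exact (h j i hij hi).symm hi

/-- If every additional edge joins vertices of different parity, then walks respect parity. -/
theorem Walk.parity {n : ℕ} {s : ℕ → Bool}
    (hs : ∀ p, 1 ≤ p → p + 3 ≤ n → s p = true → p % 2 = n % 2) {k i j : ℕ}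
    (h : Walk n s k i j) : (i + k) % 2 = j % 2 := by
  induction k generalizing j with
  | zero => cases h; rfl
  | succ k ih =>
    obtain ⟨l, -, h1, h2⟩ := h
    have := ih h1
    rcases h2 with h2 | h2 | ⟨h2, h3, h4, h5⟩ | ⟨h2, h3, h4, h5⟩
    · omega
    · omega
    · have := hs _ h3 h4 h5; omega
    · have := hs _ h3 h4 h5; omega

/-- Otherwise the graph is bipartite by parity, and walks of one length from `0` cannot reach both
`0` and `1`. -/
theorem exists_odd_of_allWalks {n : ℕ} {s : ℕ → Bool} {k : ℕ} (hn : 2 ≤ n)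
    (h : AllWalks n s k) : ∃ p, 1 ≤ p ∧ p + 3 ≤ n ∧ s p = true ∧ p % 2 ≠ n % 2 := by
  by_contra! hs
  have h0 := Walk.parity hs (h 0 (by omega) 0 (by omega))
  have h1 := Walk.parity hs (h 0 (by omega) 1 (by omega))
  omega

/-- The path serves pairs at odd distance. For even distance the detour through the chord has odd
length at most `n + i ≤ 2n-5`. -/
theorem allWalks_of_chord {n : ℕ} {s : ℕ → Bool} {i : ℕ} (hi : 1 ≤ i) (hin : i + 5 ≤ n)
    (hs : s i = true) (hp : i % 2 ≠ n % 2) : AllWalks n s (2 * n - 5) := by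
  refine allWalks_of_le fun u v huv hv => ?_
  by_cases h : (v - u) % 2 = 1
  · exact (walk_path s (huv.trans_lt hv) hv).mono (by omega) hv (by omega) (by omega)
  · exact (walk_via hi (by omega) hs (huv.trans_lt hv) hv).mono (by omega) hv (by omega) (by omega)

theorem allWalks_of_two_chords {n : ℕ} {s : ℕ → Bool} {p : ℕ} (hp : 1 ≤ p) (hpn : p + 4 ≤ n)
    (hsp : s p = true) (hs : s (n - 3) = true) : AllWalks n s (2 * n - 5) := by
  by_cases hpar : p % 2 = n % 2
  · refine allWalks_of_le fun u v huv hv => ?_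
    by_cases h : (v - u) % 2 = 1
    · exact (walk_path s (huv.trans_lt hv) hv).mono (by omega) hv (by omega) (by omega)
    -- Through `n-3` the detour has length at most `2n-5`, except for `u = v = 0`, where it is
    -- `2n-3`. That pair instead uses the closed walk `0 → p → n-1 → n-3 → 0`, of odd length `p + n
    -- - 1`.
    by_cases h0 : v = 0
    · obtain rfl : u = 0 := by omega
      subst h0
      have h1 : Walk n s _ 0 (n - 1) :=
        walk_via (v := n - 1) hp (by omega) hsp hv (by omega)
      have h2 : Walk n s 1 (n - 1) (n - 3) :=
        Walk.of_adj (by omega) (Or.inr (Or.inr (Or.inl ⟨by omega, by omega, by omega, hs⟩)))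
      have h3 := walk_path s (show n - 3 < n by omega) hv
      exact ((h1.trans h2).trans h3).mono (by omega) hv (by omega) (by omega)
    · exact (walk_via (i := n - 3) (by omega) (by omega) hs (huv.trans_lt hv) hv).mono (by omega) hv
        (by omega) (by omega)
  · exact allWalks_of_chord hp (by omega) hsp hpar

theorem allWalks_of_last_chord {n : ℕ} {s : ℕ → Bool} (hn : 4 ≤ n) (hs : s (n - 3) = true) :
    AllWalks n s (2 * n - 4) := by
  refine allWalks_of_le fun u v huv hv => ?_
  by_cases h : (v - u) % 2 = 0
  · exact (walk_path s (huv.trans_lt hv) hv).mono (by omega) hv (by omega) (by omega)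
  · exact (walk_via (i := n - 3) (by omega) (by omega) hs (huv.trans_lt hv) hv).mono (by omega) hv
      (by omega) (by omega)

/-- Walks from `0` when the only additional edge closes a triangle at the end of the path. -/
theorem Walk.lollipop {n : ℕ} {s : ℕ → Bool} (hs : ∀ p, 1 ≤ p → p + 4 ≤ n → s p = false)
    {k j : ℕ} (h : Walk n s k 0 j) (hj : j < n) :
    (k % 2 = j % 2 → j ≤ k) ∧ (k % 2 ≠ j % 2 → 2 * n ≤ k + j + 3) := by
  -- A walk of the wrong parity must go around the end triangle, so its length is at least `2n-3-j`.
  -- Using the chord between `n-3` and `n-1` swaps the two parity cases.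
  induction k generalizing j with
  | zero => cases h; simp
  | succ k ih =>
    obtain ⟨l, hl, h1, h2⟩ := h
    have h0 := ih h1 hl
    have key : ∀ p, 1 ≤ p → p + 3 ≤ n → s p = true → p + 3 = n := by
      intro p hp hp' hsp
      by_contra hne
      rw [hs p hp (by omega)] at hsp
      exact Bool.noConfusion hsp
    rcases h2 with h2 | h2 | ⟨h2, h3, h4, h5⟩ | ⟨h2, h3, h4, h5⟩
    · omega
    · omega
    · have := key _ h3 h4 h5; omega
    · have := key _ h3 h4 h5; omega

theorem allWalks_max_iff {n : ℕ} (hn : 4 ≤ n) (s : ℕ → Bool) :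
    (AllWalks n s (2 * n - 4) ∧ ¬ AllWalks n s (2 * n - 5)) ↔
      ∀ p, 1 ≤ p → p + 3 ≤ n → s p = decide (p + 3 = n) := by
  constructor
  · rintro ⟨h1, h2⟩
    obtain ⟨i, hi, hin, hs, hpar⟩ := exists_odd_of_allWalks (by omega) h1
    have hi3 : i + 3 = n := by
      by_contra hne
      exact h2 (allWalks_of_chord hi (by omega) hs hpar)
    intro p hp hpn
    by_cases h : p + 3 = n
    · obtain rfl : p = i := by omega
      simpa [h] using hs
    · rw [decide_eq_false h, ← Bool.not_eq_true]
      intro hsp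
      refine h2 (allWalks_of_two_chords hp (by omega) hsp ?_)
      rwa [show n - 3 = i by omega]
  · intro hs
    refine ⟨allWalks_of_last_chord hn ?_, fun h => ?_⟩
    · rw [hs _ (by omega) (by omega)]
      exact decide_eq_true (by omega)
    · have := Walk.lollipop (fun p hp hpn => ?_) (h 0 (by omega) 0 (by omega)) (by omega)
      · omega
      · rw [hs p hp (by omega)]
        exact decide_eq_false (by omega)

theorem numExp_max {n : ℕ} (hn : 4 ≤ n) : numExp n 0 0 (2 * n - 4) = 2 := by
  set s : ℕ → Bool := fun p => decide (p + 3 = n)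
  have key : {B | B ∈ primSymmCompanion n 0 0 ∧ primExp B = 2 * n - 4} =
      {symmOf n true s, symmOf n false s} := by
    ext B
    simp only [Set.mem_ofPred_eq, Set.mem_insert_iff, Set.mem_singleton_iff]
    have hiff : ∀ c t, (symmOf n c t ∈ primSymmCompanion n 0 0 ∧
        primExp (symmOf n c t) = 2 * n - 4) ↔ ∀ p, 1 ≤ p → p + 3 ≤ n → t p = s p := by
      intro c t
      rw [← allWalks_max_iff hn, show 2 * n - 4 = 2 * n - 5 + 1 by omega,
        symmOf_exp_eq_iff (by omega) c t _ (by omega)]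
    constructor
    · intro h
      obtain ⟨c, t, rfl⟩ := exists_eq_symmOf h.1.1
      rw [symmOf_congr ((hiff c t).1 h)]
      cases c
      · exact Or.inr rfl
      · exact Or.inl rfl
    · rintro (rfl | rfl) <;> exact (hiff _ s).2 fun _ _ _ => rfl
  rw [numExp, key, Set.ncard_pair]
  intro h
  exact Bool.noConfusion (symmOf_inj (by omega) h).1


/-! ### Reduction of exponent four to walks of length four -/

/-- The only neighbour of `0` is `1`, so a closed walk of length 3 at `0` would need a loop at `1`.
-/
theorem not_allWalks_three {n : ℕ} (hn : 5 ≤ n) (s : ℕ → Bool) : ¬ AllWalks n s 3 := by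
  intro h
  obtain ⟨a, ha, ⟨b, hb, ⟨c, hc, h0, h1⟩, h2⟩, h3⟩ := h 0 (by omega) 0 (by omega)
  obtain rfl : 0 = c := h0
  unfold Adj at h1 h2 h3
  omega

theorem symmOf_exp_four_iff {n : ℕ} (hn : 5 ≤ n) (c : Bool) (s : ℕ → Bool) :
    (symmOf n c s ∈ primSymmCompanion n 0 0 ∧ primExp (symmOf n c s) = 4) ↔ AllWalks n s 4 := by
  rw [symmOf_exp_eq_iff (by omega) c s 3 (by omega), and_iff_left (not_allWalks_three hn s)]

/-! ### The lower bound -/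

/-- Each vertex has a neighbour adjacent to the hub `n-1`; two walks of length 2 are joined there.
-/
theorem allWalks_four {n : ℕ} (hn : 5 ≤ n) {s : ℕ → Bool} (h1 : s 1 = true) (h2 : s 2 = true)
    (hl : s (n - 3) = true)
    (hs : ∀ p, 1 ≤ p → p + 5 ≤ n → s p = true ∨ s (p + 2) = true) : AllWalks n s 4 := by
  have key : ∀ u < n, Walk n s 2 u (n - 1) := by
    intro u hu
    have via : ∀ p, 1 ≤ p → p + 3 ≤ n → s p = true → (u + 1 = p ∨ p + 1 = u) →
        Walk n s 2 u (n - 1) := by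
      intro p hp hpn hsp hup
      refine ⟨p, by omega, Walk.of_adj hu ?_, Or.inr (Or.inr (Or.inr ⟨by omega, hp, hpn, hsp⟩))⟩
      rcases hup with h | h
      · exact Or.inl h
      · exact Or.inr (Or.inl h)
    by_cases hu0 : u = 0
    · exact via 1 le_rfl (by omega) h1 (by omega)
    by_cases hu1 : u = 1
    · exact via 2 (by omega) (by omega) h2 (by omega)
    by_cases hu2 : u + 1 = n
    · refine ⟨n - 2, by omega, Walk.of_adj hu (Or.inr (Or.inl (by omega))), Or.inl (by omega)⟩
    by_cases hu3 : u + 2 = n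
    · exact via (n - 3) (by omega) (by omega) hl (by omega)
    by_cases hu4 : u + 3 = n
    · refine ⟨n - 2, by omega, Walk.of_adj hu (Or.inl (by omega)), Or.inl (by omega)⟩
    rcases hs (u - 1) (by omega) (by omega) with h | h
    · exact via (u - 1) (by omega) (by omega) h (by omega)
    · exact via (u - 1 + 2) (by omega) (by omega) h (by omega)
  intro i hi j hj
  exact (key i hi).trans ((key j hj).symm (by omega))

/-- The subsets of `range L` any two elements of which differ by at least `3`. -/
def spacedSets (L : ℕ) : Finset (Finset ℕ) :=
  {Z ∈ (Finset.range L).powerset | ∀ x ∈ Z, ∀ y ∈ Z, x < y → x + 3 ≤ y}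

theorem mem_spacedSets {L : ℕ} {Z : Finset ℕ} :
    Z ∈ spacedSets L ↔ (∀ x ∈ Z, x < L) ∧ ∀ x ∈ Z, ∀ y ∈ Z, x < y → x + 3 ≤ y := by
  simp [spacedSets, Finset.subset_iff]

/-- Split subsets of `range (L + 1)` by whether they contain `L`; if so, the rest lies in `range (L
- 2)`. This matches Pascal's rule. -/
theorem choose_le_card_spacedSets (L q : ℕ) :
    Nat.choose (L + 2 - 2 * q) q ≤ {Z ∈ spacedSets L | Z.card = q}.card := by
  induction L using Nat.strong_induction_on generalizing q with
  | _ L ih =>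
  rcases q with _ | q
  · rw [Nat.choose_zero_right, Nat.one_le_iff_ne_zero, Finset.card_ne_zero]
    exact ⟨∅, by simp [mem_spacedSets]⟩
  rcases L with _ | L
  · rw [Nat.choose_eq_zero_of_lt (by omega)]
    exact Nat.zero_le _
  set A := {Z ∈ spacedSets L | Z.card = q + 1}
  set B := {Z ∈ spacedSets (L - 2) | Z.card = q}
  have hB : ∀ Z ∈ B, (∀ x ∈ Z, x + 2 < L) ∧ L ∉ Z := by
    intro Z hZ
    have h := (mem_spacedSets.1 (Finset.mem_filter.1 hZ).1).1
    exact ⟨fun x hx => by have := h x hx; omega, fun hL => by have := h L hL; omega⟩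
  have hinj : Set.InjOn (insert L) (B : Set (Finset ℕ)) := by
    intro Y hY Z hZ h
    rw [← Finset.erase_insert (hB Y hY).2, ← Finset.erase_insert (hB Z hZ).2, h]
  have hdisj : Disjoint A (B.image (insert L)) := by
    rw [Finset.disjoint_left]
    intro Z hA hZ
    obtain ⟨Y, -, rfl⟩ := Finset.mem_image.1 hZ
    have := (mem_spacedSets.1 (Finset.mem_filter.1 hA).1).1 L (Finset.mem_insert_self L Y)
    omega
  have hsub : A ∪ B.image (insert L) ⊆ {Z ∈ spacedSets (L + 1) | Z.card = q + 1} := by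
    intro Z hZ
    rw [Finset.mem_filter, mem_spacedSets]
    rcases Finset.mem_union.1 hZ with hZ | hZ
    · obtain ⟨h1, h2⟩ := Finset.mem_filter.1 hZ
      obtain ⟨h3, h4⟩ := mem_spacedSets.1 h1
      exact ⟨⟨fun x hx => (h3 x hx).trans (Nat.lt_succ_self L), h4⟩, h2⟩
    · obtain ⟨Y, hY, rfl⟩ := Finset.mem_image.1 hZ
      obtain ⟨h5, h6⟩ := hB Y hY
      obtain ⟨h1, h2⟩ := Finset.mem_filter.1 hY
      obtain ⟨h3, h4⟩ := mem_spacedSets.1 h1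
      refine ⟨⟨?_, ?_⟩, by rw [Finset.card_insert_of_notMem h6, h2]⟩
      · intro x hx
        rcases Finset.mem_insert.1 hx with rfl | hx
        · exact Nat.lt_succ_self _
        · have := h5 x hx; omega
      · intro x hx y hy hxy
        rcases Finset.mem_insert.1 hx with h | h <;> rcases Finset.mem_insert.1 hy with h' | h'
        · omega
        · have := h5 y h'; omega
        · have := h5 x h; omega
        · exact h4 x h y h' hxy
  refine le_trans ?_ (Finset.card_le_card hsub)
  rw [Finset.card_union_of_disjoint hdisj, Finset.card_image_of_injOn hinj]
  have hA' := ih L (Nat.lt_succ_self L) (q + 1)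
  have hB' := ih (L - 2) (by omega) q
  refine le_trans ?_ (Nat.add_le_add hA' hB')
  by_cases hq : 2 * q ≤ L
  · rw [show L + 1 + 2 - 2 * (q + 1) = L - 2 * q + 1 by omega,
      show L + 2 - 2 * (q + 1) = L - 2 * q by omega, Nat.choose_succ_succ', add_comm]
    exact Nat.add_le_add_left (Nat.choose_le_choose q (by omega)) _
  · rw [Nat.choose_eq_zero_of_lt (by omega)]
    exact Nat.zero_le _

theorem sum_choose_le_card_spacedSets (L Q : ℕ) :
    ∑ q ∈ Finset.Icc 0 Q, Nat.choose (L + 2 - 2 * q) q ≤ (spacedSets L).card := by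
  refine (Finset.sum_le_sum fun q _ => choose_le_card_spacedSets L q).trans ?_
  rw [← Finset.card_biUnion]
  · exact Finset.card_le_card (Finset.biUnion_subset.2 fun q _ => Finset.filter_subset _ _)
  · intro p _ q _ hpq
    rw [Function.onFun, Finset.disjoint_left]
    intro Z hp hq
    exact hpq ((Finset.mem_filter.1 hp).2.symm.trans (Finset.mem_filter.1 hq).2)

theorem numExp_set_finite (n : ℕ) (α e : ℝ) (b : ℕ) :
    {B | B ∈ primSymmCompanion n α e ∧ primExp B = b}.Finite :=
  (symmCompanion_finite n α e).subset fun _ h => h.1.1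

theorem two_mul_card_spacedSets_le_numExp {n : ℕ} (hn : 5 ≤ n) :
    2 * (spacedSets (n - 6)).card ≤ numExp n 0 0 4 := by
  set f : Bool × Finset ℕ → Matrix (Fin n) (Fin n) ℝ := fun x =>
    symmOf n x.1 fun p => decide (¬ (3 ≤ p ∧ p - 3 ∈ x.2))
  have hinj : Set.InjOn f (Finset.univ ×ˢ spacedSets (n - 6) : Finset (Bool × Finset ℕ)) := by
    rintro ⟨c, Y⟩ hY ⟨d, Z⟩ hZ h
    have hY' := (mem_spacedSets.1 (Finset.mem_product.1 hY).2).1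
    have hZ' := (mem_spacedSets.1 (Finset.mem_product.1 hZ).2).1
    obtain ⟨h1, h2⟩ := symmOf_inj (by omega) h
    have hiff : ∀ x, x + 6 ≤ n → (x ∈ Y ↔ x ∈ Z) := by
      intro x hx
      have := h2 (x + 3) (by omega) (by omega)
      simpa [not_iff_not] using this
    refine Prod.ext h1 (Finset.ext fun x => ⟨fun hx => ?_, fun hx => ?_⟩)
    · exact (hiff x (by have := hY' x hx; omega)).1 hx
    · exact (hiff x (by have := hZ' x hx; omega)).2 hx
  have hcard : (2 * (spacedSets (n - 6)).card) =
      (f '' (Finset.univ ×ˢ spacedSets (n - 6) : Finset (Bool × Finset ℕ))).ncard := by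
    rw [hinj.ncard_image, Set.ncard_coe_finset, Finset.card_product]
    rfl
  rw [hcard, numExp]
  refine Set.ncard_le_ncard ?_ (numExp_set_finite n 0 0 4)
  rintro _ ⟨⟨c, Z⟩, hZ, rfl⟩
  obtain ⟨h1, h2⟩ := mem_spacedSets.1 (Finset.mem_product.1 hZ).2
  refine (symmOf_exp_four_iff hn _ _).2 (allWalks_four hn (by simp) (by simp) ?_ ?_)
  · refine decide_eq_true fun h => ?_
    have := h1 _ h.2
    omega
  · intro p hp hpn
    by_contra h
    simp only [decide_eq_true_eq, not_or, not_not] at h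
    have := h2 _ h.1.2 _ h.2.2 (by omega)
    omega

theorem le_numExp_four {n : ℕ} (hn : 5 ≤ n) :
    2 * (∑ q ∈ Finset.Icc 0 ((n + 1) / 3), Nat.choose (n - 2 * q - 4) q) ≤ numExp n 0 0 4 := by
  refine le_trans (Nat.mul_le_mul_left 2 ?_) (two_mul_card_spacedSets_le_numExp hn)
  refine le_trans (Finset.sum_le_sum fun q _ => ?_)
    (sum_choose_le_card_spacedSets (n - 6) ((n + 1) / 3))
  -- The two upper indices can differ only at `n = 5`, where `n - 6` truncates to 0.
  exact Nat.choose_le_choose q (by omega)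

/-! ### The upper bound -/

theorem walk_four {n : ℕ} {s : ℕ → Bool} {i j : ℕ} (h : Walk n s 4 i j) :
    ∃ p < n, ∃ l < n, ∃ q < n, Adj n s i p ∧ Adj n s p l ∧ Adj n s l q ∧ Adj n s q j := by
  obtain ⟨q, hq, ⟨l, hl, ⟨p, hp, ⟨i', hi, rfl, h1⟩, h2⟩, h3⟩, h4⟩ := h
  exact ⟨p, hp, l, hl, q, hq, h1, h2, h3, h4⟩

/-- A walk of length 4 from `0` to `1` starts with `0 → 1`, so the rest is a triangle at `1`,
necessarily on `1, 2, n-1`. -/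
theorem AllWalks.one_two {n : ℕ} {s : ℕ → Bool} (hn : 5 ≤ n) (h : AllWalks n s 4) :
    s 1 = true ∧ s 2 = true := by
  obtain ⟨p, hp, l, hl, q, hq, h1, h2, h3, h4⟩ := walk_four (h 0 (by omega) 1 (by omega))
  obtain rfl : p = 1 := by unfold Adj at h1; omega
  unfold Adj at *
  grind

/-- In a walk of length 4 from `j` to `j-1`, the middle vertex lies in `{j-2, j, j+2}` and the next
in `{j-2, j}`, but no edge joins these. -/
theorem AllWalks.not_three {n : ℕ} {s : ℕ → Bool} (h : AllWalks n s 4) {j : ℕ}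
    (hj : 2 ≤ j) (hjn : j + 4 ≤ n) :
    ¬ (s (j - 1) = false ∧ s j = false ∧ s (j + 1) = false) := by
  rintro ⟨ha, hb, hc⟩
  obtain ⟨p, hp, l, hl, q, hq, h1, h2, h3, h4⟩ := walk_four (h j (by omega) (j - 1) (by omega))
  unfold Adj at *
  have hp' : p + 1 = j ∨ p = j + 1 := by grind
  have hl' : l + 2 = j ∨ l = j ∨ l = j + 2 := by grind
  have hq' : q + 2 = j ∨ q = j := by grind
  grind

/-- In a walk of length 4 from `j` to `j+1`, the middle vertex and the next both lie in `{j-2, j,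
j+2, n-1}`, an independent set. For `j = n-3`, the vertex `j+2` is the hub itself. -/
theorem AllWalks.not_alternating {n : ℕ} {s : ℕ → Bool} (h : AllWalks n s 4) {j : ℕ}
    (hj : 3 ≤ j) (hjn : j + 3 ≤ n) (ha : s (j - 2) = false) (hb : s j = false)
    (hc : j + 3 = n ∨ (j + 5 ≤ n ∧ s (j + 2) = false)) : False := by
  obtain ⟨p, hp, l, hl, q, hq, h1, h2, h3, h4⟩ := walk_four (h j (by omega) (j + 1) (by omega))
  unfold Adj at *
  have hp' : p + 1 = j ∨ p = j + 1 := by grind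
  have hl' : l + 2 = j ∨ l = j ∨ l = j + 2 ∨ l + 1 = n := by grind
  have hq' : q = j ∨ q = j + 2 ∨ q + 1 = n := by grind
  have hl'' : l + 2 = j → s l = false := by
    rintro rfl
    exact ha
  rcases hl' with hl' | hl' | hl' | hl' <;> rcases hq' with hq' | hq' | hq' <;> grind

/-! ### Counting zeros under forbidden patterns -/

/-- Any five consecutive positions contain at most two marked ones. The constant 4 is attained by
the pattern `101` at `L = 3`. -/
theorem count_le_of_no_alternating (z : ℕ → Prop) [DecidablePred z] (L : ℕ)
    (h2 : ∀ i, i + 1 < L → ¬ (z i ∧ z (i + 1)))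
    (h3 : ∀ i, i + 4 < L → ¬ (z i ∧ z (i + 2) ∧ z (i + 4))) :
    5 * Nat.count z L ≤ 2 * L + 4 := by
  induction L using Nat.strong_induction_on with
  | _ L ih =>
  by_cases hL : 5 ≤ L
  · obtain ⟨M, rfl⟩ := Nat.exists_eq_add_of_le' hL
    have h0 := ih M (by omega) (fun i hi => h2 i (by omega)) (fun i hi => h3 i (by omega))
    have e0 := h2 M (by omega)
    have e1 := h2 (M + 1) (by omega)
    have e2 := h2 (M + 2) (by omega)
    have e3 := h2 (M + 3) (by omega)
    have e4 := h3 M (by omega)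
    have : Nat.count z (M + 5) ≤ Nat.count z M + 2 := by
      rw [Nat.count_succ, Nat.count_succ, Nat.count_succ, Nat.count_succ, Nat.count_succ]
      split_ifs <;> first | omega | (exfalso; tauto)
    omega
  · have e0 := h2 0
    have e1 := h2 1
    have e2 := h2 2
    interval_cases L
    · simp
    · have := Nat.count_le (p := z) (n := 1)
      omega
    all_goals
      simp only [Nat.count_succ, Nat.count_zero]
      norm_num at e0 e1 e2
      split_ifs <;> first | omega | (exfalso; tauto)

theorem count_le_of_no_three (z : ℕ → Prop) [DecidablePred z] (L : ℕ)
    (h : ∀ i, i + 2 < L → ¬ (z i ∧ z (i + 1) ∧ z (i + 2))) :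
    3 * Nat.count z L ≤ 2 * L + 2 := by
  induction L using Nat.strong_induction_on with
  | _ L ih =>
  by_cases hL : 3 ≤ L
  · obtain ⟨M, rfl⟩ := Nat.exists_eq_add_of_le' hL
    have h0 := ih M (by omega) (fun i hi => h i (by omega))
    have e0 := h M (by omega)
    have : Nat.count z (M + 3) ≤ Nat.count z M + 2 := by
      rw [Nat.count_succ, Nat.count_succ, Nat.count_succ]
      split_ifs <;> first | omega | (exfalso; tauto)
    omega
  · have := Nat.count_le (p := z) (n := L)
    omega

/-- The last row `0, 1, 1, Y, _, 0` as a function of the index. -/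
def extend {m : ℕ} (Y : Fin m → Bool) (p : ℕ) : Bool :=
  if h : 3 ≤ p ∧ p - 3 < m then Y ⟨p - 3, h.2⟩ else true

theorem extend_add_three {m : ℕ} (Y : Fin m → Bool) {i : ℕ} (hi : i < m) :
    extend Y (i + 3) = Y ⟨i, hi⟩ := by
  simp [extend, hi]

theorem extend_add_three_of_le {m : ℕ} (Y : Fin m → Bool) {i : ℕ} (hi : m ≤ i) :
    extend Y (i + 3) = true := by
  simp [extend, hi]

theorem ncard_zeros_eq_count {m : ℕ} (Y : Fin m → Bool) :
    {j : Fin m | Y j = false}.ncard = Nat.count (fun i => extend Y (i + 3) = false) m := by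
  rw [Nat.count_eq_card_filter_range, ← Set.ncard_coe_finset,
    ← Set.ncard_image_of_injective _ Fin.val_injective]
  congr 1
  ext i
  simp only [Set.mem_image, Set.mem_ofPred_eq, Finset.coe_filter, Finset.mem_range]
  constructor
  · rintro ⟨j, hj, rfl⟩
    exact ⟨j.isLt, by rw [extend_add_three Y j.isLt]; exact hj⟩
  · rintro ⟨hi, h⟩
    exact ⟨⟨i, hi⟩, by rwa [extend_add_three Y hi] at h, rfl⟩

theorem HasZeroRun.mono {m : ℕ} {Y : Fin m → Bool} {k l : ℕ} (h : HasZeroRun Y l) (hkl : k ≤ l) :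
    HasZeroRun Y k := by
  obtain ⟨a, ha, h⟩ := h
  exact ⟨a, by omega, fun j h1 h2 => h j h1 (by omega)⟩

theorem HasZeroRun.le_ncard {m : ℕ} {Y : Fin m → Bool} {k : ℕ} (h : HasZeroRun Y k) :
    k ≤ {j : Fin m | Y j = false}.ncard := by
  obtain ⟨a, ha, h⟩ := h
  have hinj : Function.Injective fun i : Fin k => (⟨a + i.val, by omega⟩ : Fin m) := by
    intro i j hij
    have := congrArg Fin.val hij
    exact Fin.ext (by simpa using this)
  calc k = (Set.range fun i : Fin k => (⟨a + i.val, by omega⟩ : Fin m)).ncard := by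
        rw [← Set.image_univ, Set.ncard_image_of_injective _ hinj, Set.ncard_univ, Nat.card_fin]
    _ ≤ _ := by
        refine Set.ncard_le_ncard ?_ (Set.toFinite _)
        rintro _ ⟨i, rfl⟩
        exact h _ (by simp) (by simp)

theorem HasZeroRun.isGreatest {m : ℕ} {Y : Fin m → Bool} {k : ℕ} (h : HasZeroRun Y k)
    (h' : ¬ HasZeroRun Y (k + 1)) : IsGreatest {l : ℕ | HasZeroRun Y l} k := by
  refine ⟨h, fun l hl => ?_⟩
  by_contra! hlt
  exact h' (HasZeroRun.mono hl hlt)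

theorem hasZeroRun_extend {m : ℕ} {Y : Fin m → Bool} {a k : ℕ} (hk : a + k ≤ m)
    (h : ∀ i < k, extend Y (a + i + 3) = false) : HasZeroRun Y k := by
  refine ⟨a, hk, fun j h1 h2 => ?_⟩
  have := h (j.val - a) (by omega)
  rwa [show a + (j.val - a) + 3 = j.val + 3 by omega, extend_add_three Y j.isLt] at this

/-- The strings whose matrix has exponent `4`. -/
def expFourStrings (n : ℕ) : Set (Fin (n - 5) → Bool) := {Y | AllWalks n (extend Y) 4}

theorem no_three_zeros {n : ℕ} {Y : Fin (n - 5) → Bool} (hY : Y ∈ expFourStrings n) {i : ℕ}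
    (hi : i + 2 < n - 5) : ¬ (extend Y (i + 3) = false ∧ extend Y (i + 1 + 3) = false ∧
      extend Y (i + 2 + 3) = false) :=
  AllWalks.not_three (j := i + 4) hY (by omega) (by omega)

theorem not_hasZeroRun_three {n : ℕ} {Y : Fin (n - 5) → Bool} (hY : Y ∈ expFourStrings n) :
    ¬ HasZeroRun Y 3 := by
  rintro ⟨a, ha, h⟩
  refine no_three_zeros hY (i := a) (by omega) ⟨?_, ?_, ?_⟩ <;>
  · rw [extend_add_three Y (by omega)]
    exact h _ (by simp) (by simp)

theorem ncard_zeros_le_of_run_two {n : ℕ} (hn : 5 ≤ n) {Y : Fin (n - 5) → Bool}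
    (hY : Y ∈ expFourStrings n) : {j | Y j = false}.ncard ≤ (2 * n + 2) / 3 := by
  rw [ncard_zeros_eq_count]
  have := count_le_of_no_three (fun i => extend Y (i + 3) = false) (n - 5)
    fun i hi => no_three_zeros hY hi
  omega

theorem ncard_zeros_le_of_run_one {n : ℕ} (hn : 5 ≤ n) {Y : Fin (n - 5) → Bool}
    (hY : Y ∈ expFourStrings n) (h2 : ¬ HasZeroRun Y 2) :
    {j | Y j = false}.ncard ≤ (2 * n - 7) / 5 := by
  rw [ncard_zeros_eq_count]
  have hlt : ∀ {i}, extend Y (i + 3) = false → i < n - 5 := by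
    intro i hi
    by_contra! h
    rw [extend_add_three_of_le Y h] at hi
    exact Bool.noConfusion hi
  -- Index `i` stands for vertex `i + 3`. A virtual zero at index `n-4`, the hub, encodes the
  -- boundary case `j + 3 = n` of `AllWalks.not_alternating`; for `q` zeros, length `n-3` yields `5
  -- (q + 1) ≤ 2n - 2`.
  have hcount : Nat.count (fun i => extend Y (i + 3) = false ∨ i = n - 4) (n - 5 + 2) =
      Nat.count (fun i => extend Y (i + 3) = false) (n - 5) + 1 := by
    rw [Nat.count_succ, Nat.count_succ, if_neg, if_pos (by omega), add_zero]
    · congr 1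
      rw [Nat.count_eq_card_filter_range, Nat.count_eq_card_filter_range]
      congr 1
      refine Finset.filter_congr fun i hi => or_iff_left ?_
      have := Finset.mem_range.1 hi
      omega
    · rw [extend_add_three_of_le Y le_rfl]
      simp
      omega
  have := count_le_of_no_alternating (fun i => extend Y (i + 3) = false ∨ i = n - 4) (n - 5 + 2)
    ?_ ?_
  · omega
  · rintro i hi ⟨ha | ha, hb | hb⟩
    · have hb' := hlt hb
      refine h2 (hasZeroRun_extend (a := i) (by omega) fun k hk => ?_)
      interval_cases k
      · exact ha
      · exact hb
    · have := hlt ha; omega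
    · have := hlt hb; omega
    · omega
  · rintro i hi ⟨ha | ha, hb | hb, hc⟩
    · have hb' := hlt hb
      refine AllWalks.not_alternating (j := i + 5) hY (by omega) (by omega) ha hb ?_
      rcases hc with hc | hc
      · have := hlt hc
        exact Or.inr ⟨by omega, hc⟩
      · exact Or.inl (by omega)
    · omega
    · omega
    · omega

theorem expFourStrings_subset {n : ℕ} (hn : 5 ≤ n) : expFourStrings n ⊆
    (⋃ q ∈ Finset.Icc 1 ((2 * n - 7) / 5), {Y : Fin (n - 5) → Bool |
      {j | Y j = false}.ncard = q ∧ IsGreatest {l : ℕ | HasZeroRun Y l} 1}) ∪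
    (⋃ q ∈ Finset.Icc 2 ((2 * n + 2) / 3), {Y : Fin (n - 5) → Bool |
      {j | Y j = false}.ncard = q ∧ IsGreatest {l : ℕ | HasZeroRun Y l} 2}) ∪
    {fun _ => true} := by
  intro Y hY
  by_cases h2 : HasZeroRun Y 2
  · refine Or.inl (Or.inr (Set.mem_biUnion (Finset.mem_Icc.2 ⟨h2.le_ncard, ?_⟩)
      ⟨rfl, h2.isGreatest (not_hasZeroRun_three hY)⟩))
    exact ncard_zeros_le_of_run_two hn hY
  by_cases h1 : HasZeroRun Y 1
  · refine Or.inl (Or.inl (Set.mem_biUnion (Finset.mem_Icc.2 ⟨h1.le_ncard, ?_⟩)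
      ⟨rfl, h1.isGreatest h2⟩))
    exact ncard_zeros_le_of_run_one hn hY h2
  · refine Or.inr (Set.mem_singleton_iff.2 (funext fun j => ?_))
    rw [← Bool.not_eq_false]
    intro hj
    refine h1 ⟨j, j.isLt, fun i h h' => ?_⟩
    obtain rfl : i = j := Fin.ext (by omega)
    exact hj

theorem ncard_expFourStrings_le {n : ℕ} (hn : 5 ≤ n) : (expFourStrings n).ncard ≤
    (∑ q ∈ Finset.Icc 1 ((2 * n - 7) / 5), numStrings (n - 5) q 1) +
      (∑ q ∈ Finset.Icc 2 ((2 * n + 2) / 3), numStrings (n - 5) q 2) + 1 := by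
  refine (Set.ncard_le_ncard (expFourStrings_subset hn) (Set.toFinite _)).trans ?_
  refine (Set.ncard_union_le _ _).trans (Nat.add_le_add ((Set.ncard_union_le _ _).trans
    (Nat.add_le_add ?_ ?_)) (Set.ncard_singleton _).le)
  · exact Finset.set_ncard_biUnion_le _ _
  · exact Finset.set_ncard_biUnion_le _ _

theorem numExp_four_le {n : ℕ} (hn : 5 ≤ n) :
    numExp n 0 0 4 ≤ 2 * (expFourStrings n).ncard := by
  set f : Bool × (Fin (n - 5) → Bool) → Matrix (Fin n) (Fin n) ℝ := fun x =>
    symmOf n x.1 (extend x.2)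
  have hsub : {B | B ∈ primSymmCompanion n 0 0 ∧ primExp B = 4} ⊆
      f '' (Set.univ ×ˢ expFourStrings n) := by
    intro B hB
    obtain ⟨c, s, rfl⟩ := exists_eq_symmOf hB.1.1
    obtain ⟨h1, h2⟩ := ((symmOf_exp_four_iff hn c s).1 hB).one_two hn
    have heq : symmOf n c s = symmOf n c (extend fun j : Fin (n - 5) => s (j.val + 3)) := by
      refine symmOf_congr fun p hp hpn => ?_
      by_cases h3 : 3 ≤ p
      · obtain ⟨i, rfl⟩ := Nat.exists_eq_add_of_le' h3
        rw [extend_add_three _ (by omega)]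
      · rw [extend, dif_neg (by omega)]
        obtain rfl | rfl : p = 1 ∨ p = 2 := by omega
        · exact h1
        · exact h2
    refine ⟨(c, fun j => s (j.val + 3)), ⟨Set.mem_univ _, ?_⟩, heq.symm⟩
    have hB' : _ ∧ _ := hB
    rw [heq] at hB'
    exact (symmOf_exp_four_iff hn c _).1 hB'
  calc numExp n 0 0 4 ≤ (f '' (Set.univ ×ˢ expFourStrings n)).ncard :=
        Set.ncard_le_ncard hsub (Set.toFinite _)
    _ ≤ (Set.univ ×ˢ expFourStrings n : Set (Bool × _)).ncard :=
        Set.ncard_image_le (Set.toFinite _)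
    _ = 2 * (expFourStrings n).ncard := by
        rw [Set.ncard_prod, Set.ncard_univ, Nat.card_eq_fintype_card, Fintype.card_bool]

end SymmCompanion

theorem mainTheorem7 :
    (∀ n : ℕ, 4 ≤ n → SymmCompanion.numExp n 0 0 (2 * n - 4) = 2) ∧
    (∀ n : ℕ, 5 ≤ n →
      2 * (∑ q ∈ Finset.Icc 0 ((n + 1) / 3), Nat.choose (n - 2 * q - 4) q)
          ≤ SymmCompanion.numExp n 0 0 4 ∧
      SymmCompanion.numExp n 0 0 4 ≤
        2 * ((∑ q ∈ Finset.Icc 1 ((2 * n - 7) / 5), SymmCompanion.numStrings (n - 5) q 1)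
          + (∑ q ∈ Finset.Icc 2 ((2 * n + 2) / 3), SymmCompanion.numStrings (n - 5) q 2)
          + 1)) := by
  refine ⟨fun n hn => SymmCompanion.numExp_max hn, fun n hn =>
    ⟨SymmCompanion.le_numExp_four hn, (SymmCompanion.numExp_four_le hn).trans ?_⟩⟩
  exact Nat.mul_le_mul_left 2 (SymmCompanion.ncard_expFourStrings_le hn)
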